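/- Let $\mathscr{M}$ be a $II_1$ factor acting on a complex Hilbert space $\mathscr{H}$, with faithful normal tracial state $\tau$. For $\varepsilon,\delta>0$ let $\mathcal{O}_\tau(\varepsilon,\delta)$ be the set of all $A\in\mathscr{M}$ for which there is a projection $E\in\mathscr{M}$ with $\|AE\|\le\varepsilon$ and $\tau(I-E)\le\delta$. The measure topology on $\mathscr{M}$ is the translation-invariant topology for which the sets $\mathcal{O}_\tau(\varepsilon,\delta)$ form a fundamental system of neighborhoods of $0$. Let $\widetilde{\mathscr{M}}$ be the completion of $\mathscr{M}$ in this topology, with addition, scalar multiplication, multiplication and adjoint extended by continuity from $\mathscr{M}$. Let $\mathscr{M}^{\mathrm{sa}}$ and $\mathscr{M}^{+}$ be the sets of self-adjoint and of positive operators in $\mathscr{M}$. Then: (i) $\mathscr{M}^{\mathrm{sa}}$ is closed in $\mathscr{M}$ in the measure topology, and the closure of $\mathscr{M}^{\mathrm{sa}}$ in $\widetilde{\mathscr{M}}$ is $\widetilde{\mathscr{M}}^{\mathrm{sa}}$, the set of self-adjoint elements of $\widetilde{\mathscr{M}}$. (ii) $\mathscr{M}^{+}$ is closed in $\mathscr{M}$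 in the measure topology, and its closure $\widetilde{\mathscr{M}}^{+}$ in $\widetilde{\mathscr{M}}$ is a cone, that is, it contains $0$, is closed under addition and under multiplication by positive real numbers, and satisfies $\widetilde{\mathscr{M}}^{+}\cap(-\widetilde{\mathscr{M}}^{+})=\{0\}$. Moreover, $(\widetilde{\mathscr{M}};\widetilde{\mathscr{M}}^{+})$ is an ordered complex topological $*$-algebra: $\widetilde{\mathscr{M}}$ is a complex $*$-algebra in which addition, multiplication, scalar multiplication and the adjoint are continuous, $\widetilde{\mathscr{M}}^{+}\subseteq\widetilde{\mathscr{M}}^{\mathrm{sa}}$, and the relation $A\le B \iff B-A\in\widetilde{\mathscr{M}}^{+}$ is a partial order on $\widetilde{\mathscr{M}}^{\mathrm{sa}}$ making it an ordered real vector space. -/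

import Mathlib

open scoped ComplexOrder

noncomputable section

namespace MeasureTopology

variable {H : Type*} [NormedAddCommGroup H] [InnerProductSpace ℂ H] [CompleteSpace H]

/-- A factor of type II₁: a von Neumann algebra with trivial center, in which the identity is a
finite projection, and which contains no nonzero abelian projection. -/
structure IsTypeII1Factor (M : VonNeumannAlgebra H) : Prop where
  ne_zero : (1 : H →L[ℂ] H) ≠ 0
  center_trivial : ∀ z ∈ M, z ∈ M.commutant → ∃ c : ℂ, z = c • (1 : H →L[ℂ] H)
  finite : ∀ v ∈ M, star v * v = 1 → v * star v = 1
  no_abelian_projection : ∀ E ∈ M, IsStarProjection E →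
    (∀ a ∈ M, ∀ b ∈ M, Commute (E * a * E) (E * b * E)) → E = 0

/-- A faithful normal tracial state on a von Neumann algebra. The order on operators is the
Loewner order. Normality: the state respects least upper bounds of increasing nets (equivalently,
of nonempty upward directed sets) of self-adjoint elements. -/
structure FaithfulNormalTracialState (M : VonNeumannAlgebra H) where
  toLinearMap : M.toStarSubalgebra →ₗ[ℂ] ℂ
  map_one : toLinearMap 1 = 1
  nonneg : ∀ a, 0 ≤ a → 0 ≤ toLinearMap a
  tracial : ∀ a b, toLinearMap (a * b) = toLinearMap (b * a)
  faithful : ∀ a, 0 ≤ a → toLinearMap a = 0 → a = 0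
  normal : ∀ (S : Set M.toStarSubalgebra) (x : M.toStarSubalgebra), S.Nonempty →
    (∀ a ∈ S, IsSelfAdjoint a) → DirectedOn (· ≤ ·) S → IsLUB S x →
    IsLUB ((fun a => (toLinearMap a).re) '' S) (toLinearMap x).re

theorem exists_resolvent {T : H →L[ℂ] H} (hT : 0 ≤ T) (n : ℕ) :
    ∃ u : (H →L[ℂ] H)ˣ, (u : H →L[ℂ] H) = 1 + (n : ℂ) • T := by
  have h1 : (1 : H →L[ℂ] H) ≤ 1 + (n : ℂ) • T := by
    have : 0 ≤ (n : ℂ) • T := smul_nonneg (by positivity) hT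
    simpa using this
  obtain ⟨u, hu⟩ := CStarAlgebra.isUnit_of_le (1 : H →L[ℂ] H) h1
  exact ⟨u, hu⟩

theorem exists_range_proj (M : VonNeumannAlgebra H) {X : H →L[ℂ] H} (hX : X ∈ M) :
    ∃ P ∈ M, IsStarProjection P ∧ P * X = X ∧ (∀ Y : H →L[ℂ] H, Y * X = 0 → Y * P = 0) ∧
      ∀ x : H, P x ∈ closure (Set.range X) := by
  let K : Submodule ℂ H := X.range.topologicalClosure
  have : CompleteSpace K := (Submodule.isClosed_topologicalClosure _).completeSpace_coe
  have hK : (K : Set H) = closure (Set.range X) := by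
    rw [Submodule.topologicalClosure_coe]; rfl
  refine ⟨K.starProjection, ?_, isStarProjection_starProjection, ?_, ?_, ?_⟩
  · rw [VonNeumannAlgebra.IsStarProjection.mem_iff isStarProjection_starProjection]
    intro y hy
    rw [Module.End.mem_invtSubmodule, Submodule.range_starProjection]
    intro v hv
    have hv' : v ∈ closure (Set.range X) := by rw [← hK]; exact hv
    change y v ∈ (K : Set H)
    rw [hK]
    refine map_mem_closure y.continuous hv' ?_
    rintro _ ⟨w, rfl⟩
    refine ⟨y w, ?_⟩
    have := (VonNeumannAlgebra.mem_commutant_iff.1 hy) X hX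
    exact congrArg (fun f : H →L[ℂ] H => f w) this
  · ext v
    simp only [mul_apply_eq_comp]
    rw [Submodule.starProjection_eq_self_iff]
    exact Submodule.le_topologicalClosure _ ⟨v, rfl⟩
  · intro Y hY
    ext v
    simp only [mul_apply_eq_comp, zero_apply]
    have : K.starProjection v ∈ closure (Set.range X) := by
      rw [← hK]; exact Submodule.starProjection_apply_mem _ _
    have h2 : closure (Set.range X) ⊆ {w | Y w = 0} := by
      refine closure_minimal ?_ (isClosed_eq Y.continuous continuous_const)
      rintro _ ⟨w, rfl⟩
      exact congrArg (fun f : H →L[ℂ] H => f w) hY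
    exact h2 this
  · intro v
    rw [← hK]; exact Submodule.starProjection_apply_mem _ _

theorem inv_mem (M : VonNeumannAlgebra H) {u : (H →L[ℂ] H)ˣ} (hu : (u : H →L[ℂ] H) ∈ M) :
    ((u⁻¹ : (H →L[ℂ] H)ˣ) : H →L[ℂ] H) ∈ M := by
  rw [← VonNeumannAlgebra.commutant_commutant M, VonNeumannAlgebra.mem_commutant_iff]
  intro g hg
  have : Commute g (u : H →L[ℂ] H) := 
    ((VonNeumannAlgebra.mem_commutant_iff.1 hg) _ hu).symm
  exact this.units_inv_right

theorem one_sub_le_proj {c Q : H →L[ℂ] H} (hc : 0 ≤ c) (hQ : IsStarProjection Q)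
    (h : (1 - c) * Q = 1 - c) : 1 - c ≤ Q := by
  have hs : star c = c := (IsSelfAdjoint.of_nonneg hc).star_eq
  have hQs : star Q = Q := hQ.isSelfAdjoint.star_eq
  have h2 : Q * (1 - c) = 1 - c := by
    have := congrArg star h
    rwa [star_mul, star_sub, star_one, hQs, hs] at this
  have e3 : Q - (1 - c) = Q * c * star Q := by
    have e4 : Q * (1 - c) * Q = 1 - c := by rw [h2, h]
    rw [mul_sub, sub_mul, mul_one, hQ.isIdempotentElem.eq] at e4
    rw [hQs, ← e4]; abel
  rw [← sub_nonneg, e3]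
  exact star_right_conjugate_nonneg hc _

variable {M : VonNeumannAlgebra H} (τ : FaithfulNormalTracialState M)

theorem tr_mono {a b : M.toStarSubalgebra} (h : a ≤ b) :
    (τ.toLinearMap a).re ≤ (τ.toLinearMap b).re := by
  have h1 : 0 ≤ b - a := by
    have : (a : H →L[ℂ] H) ≤ b := h
    have h2 : (0 : H →L[ℂ] H) ≤ b - a := sub_nonneg.2 this
    exact h2
  have := (Complex.le_def.1 (τ.nonneg _ h1)).1
  simpa using this

theorem exists_range_proj_tr {X G : M.toStarSubalgebra} (hG : IsStarProjection G)
    (hXG : X * G = X) :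
    ∃ P : M.toStarSubalgebra, IsStarProjection P ∧ P * X = X ∧
      (∀ Y : M.toStarSubalgebra, Y * X = 0 → Y * P = 0) ∧
      (τ.toLinearMap P).re ≤ (τ.toLinearMap G).re := by
  obtain ⟨P, hPM, hP, hPX, hPmin, hPcl⟩ := exists_range_proj M (X := (X : H →L[ℂ] H)) X.2
  set X' : H →L[ℂ] H := (X : H →L[ℂ] H) with hX'
  have hT : 0 ≤ X' * star X' := mul_star_self_nonneg X'
  have hS : 0 ≤ star X' * X' := star_mul_self_nonneg X'
  choose u hu using exists_resolvent hT
  choose v hv using exists_resolvent hS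
  have hXM : X' ∈ M := X.2
  have hXsM : star X' ∈ M := star_mem hXM
  have hsm : ∀ (c : ℂ) {y : H →L[ℂ] H}, y ∈ M → c • y ∈ M := fun c y hy =>
    M.toStarSubalgebra.smul_mem hy c
  have huM : ∀ n, ((u n)⁻¹ : (H →L[ℂ] H)ˣ).val ∈ M := fun n => inv_mem M (by
    rw [hu]; exact add_mem (one_mem _) (hsm _ (mul_mem hXM hXsM)))
  have hvM : ∀ n, ((v n)⁻¹ : (H →L[ℂ] H)ˣ).val ∈ M := fun n => inv_mem M (by
    rw [hv]; exact add_mem (one_mem _) (hsm _ (mul_mem hXsM hXM)))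
  have hu1 : ∀ n, 1 ≤ (u n : H →L[ℂ] H) := fun n => by
    have : 0 ≤ (n : ℂ) • (X' * star X') := smul_nonneg (by positivity) hT
    rw [hu]; simpa using this
  have hv1 : ∀ n, 1 ≤ (v n : H →L[ℂ] H) := fun n => by
    have : 0 ≤ (n : ℂ) • (star X' * X') := smul_nonneg (by positivity) hS
    rw [hv]; simpa using this
  have hu0 : ∀ n, 0 ≤ ((u n)⁻¹ : (H →L[ℂ] H)ˣ).val := fun n =>
    CFC.inv_nonneg_of_nonneg _ (zero_le_one.trans (hu1 n))
  have hv0 : ∀ n, 0 ≤ ((v n)⁻¹ : (H →L[ℂ] H)ˣ).val := fun n =>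
    CFC.inv_nonneg_of_nonneg _ (zero_le_one.trans (hv1 n))
  have hule : ∀ n, ((u n)⁻¹ : (H →L[ℂ] H)ˣ).val ≤ 1 := fun n => CStarAlgebra.inv_le_one (hu1 n)
  have hXd : ∀ n, ((u n)⁻¹ : (H →L[ℂ] H)ˣ).val * X' = X' * ((v n)⁻¹ : (H →L[ℂ] H)ˣ).val := by
    intro n
    rw [Units.inv_mul_eq_iff_eq_mul, ← mul_assoc, Units.eq_mul_inv_iff_mul_eq, hu, hv]
    simp [mul_add, add_mul, mul_assoc]
  have hcT : ∀ n : ℕ, (n : ℂ) • (((u n)⁻¹ : (H →L[ℂ] H)ˣ).val * (X' * star X'))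
      = 1 - ((u n)⁻¹ : (H →L[ℂ] H)ˣ).val := by
    intro n
    have h : (n : ℂ) • (X' * star X') = (u n : H →L[ℂ] H) - 1 := by rw [hu]; simp
    rw [← mul_smul_comm, h, mul_sub]; simp
  have hdS : ∀ n : ℕ, (n : ℂ) • (((v n)⁻¹ : (H →L[ℂ] H)ˣ).val * (star X' * X'))
      = 1 - ((v n)⁻¹ : (H →L[ℂ] H)ˣ).val := by
    intro n
    have h : (n : ℂ) • (star X' * X') = (v n : H →L[ℂ] H) - 1 := by rw [hv]; simp
    rw [← mul_smul_comm, h, mul_sub]; simp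
  have hPX' : (1 - P) * X' = 0 := by rw [sub_mul, hPX]; simp
  have hXP' : star X' * (1 - P) = 0 := by
    have := congrArg star hPX'
    simpa [hP.isSelfAdjoint.star_eq] using this
  let a : ℕ → M.toStarSubalgebra := fun n =>
    ⟨1 - ((u n)⁻¹ : (H →L[ℂ] H)ˣ).val, sub_mem (one_mem _) (huM n)⟩
  let b : ℕ → M.toStarSubalgebra := fun n =>
    ⟨1 - ((v n)⁻¹ : (H →L[ℂ] H)ˣ).val, sub_mem (one_mem _) (hvM n)⟩
  have hab : ∀ n, τ.toLinearMap (a n) = τ.toLinearMap (b n) := by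
    intro n
    let d : M.toStarSubalgebra := ⟨((v n)⁻¹ : (H →L[ℂ] H)ˣ).val, hvM n⟩
    have h1 : a n = X * ((n : ℂ) • (d * star X)) := by
      apply Subtype.ext
      change 1 - ((u n)⁻¹ : (H →L[ℂ] H)ˣ).val =
        X' * ((n : ℂ) • (((v n)⁻¹ : (H →L[ℂ] H)ˣ).val * star X'))
      rw [← hcT, mul_smul_comm, ← mul_assoc, hXd, mul_assoc]
    have h2 : b n = ((n : ℂ) • (d * star X)) * X := by
      apply Subtype.ext
      change 1 - ((v n)⁻¹ : (H →L[ℂ] H)ˣ).val =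
        ((n : ℂ) • (((v n)⁻¹ : (H →L[ℂ] H)ˣ).val * star X')) * X'
      rw [← hdS, smul_mul_assoc, mul_assoc]
    rw [h1, h2, τ.tracial]
  have hbG : ∀ n, b n ≤ G := by
    intro n
    have hG1 : IsStarProjection (G : H →L[ℂ] H) :=
      ⟨congrArg Subtype.val hG.isIdempotentElem.eq, congrArg Subtype.val hG.isSelfAdjoint.star_eq⟩
    have hXG' : X' * (G : H →L[ℂ] H) = X' := congrArg Subtype.val hXG
    refine one_sub_le_proj (hv0 n) hG1 ?_
    rw [← hdS, smul_mul_assoc, mul_assoc, mul_assoc, hXG']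
  have hmono : Monotone a := by
    intro m n hmn
    have h : (u m : H →L[ℂ] H) ≤ u n := by
      rw [hu, hu]
      have : 0 ≤ ((n : ℂ) - m) • (X' * star X') := smul_nonneg (by
        rw [sub_nonneg]; exact_mod_cast hmn) hT
      rw [sub_smul] at this
      simpa using this
    have h2 := CStarAlgebra.inv_le_inv (zero_le_one.trans (hu1 m)) h
    exact sub_le_sub_left h2 1
  have hlub : IsLUB (Set.range a) (⟨P, hPM⟩ : M.toStarSubalgebra) := by
    have hcP : ∀ n, ((u n)⁻¹ : (H →L[ℂ] H)ˣ).val * (1 - P) = 1 - P := by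
      intro n
      have h : (1 - ((u n)⁻¹ : (H →L[ℂ] H)ˣ).val) * (1 - P) = 0 := by
        rw [← hcT, smul_mul_assoc, mul_assoc, mul_assoc, hXP']; simp
      rw [sub_mul, one_mul, sub_eq_zero] at h
      exact h.symm
    have hcn : ∀ n, ‖((u n)⁻¹ : (H →L[ℂ] H)ˣ).val‖ ≤ 1 := fun n =>
      (CStarAlgebra.norm_le_one_iff_of_nonneg _ (hu0 n)).2 (hule n)
    have hcn' : ∀ n, ‖1 - ((u n)⁻¹ : (H →L[ℂ] H)ˣ).val‖ ≤ 1 := fun n =>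
      (CStarAlgebra.norm_le_one_iff_of_nonneg _ (sub_nonneg.2 (hule n))).2
        (sub_le_self _ (hu0 n))
    have hcX : ∀ n : ℕ, (n : ℝ) * ‖((u n)⁻¹ : (H →L[ℂ] H)ˣ).val * X'‖ ^ 2 ≤ 1 := by
      intro n
      have hs : star ((u n)⁻¹ : (H →L[ℂ] H)ˣ).val = ((u n)⁻¹ : (H →L[ℂ] H)ˣ).val :=
        (IsSelfAdjoint.of_nonneg (hu0 n)).star_eq
      have h1 : ((u n)⁻¹ : (H →L[ℂ] H)ˣ).val * X' * star (((u n)⁻¹ : (H →L[ℂ] H)ˣ).val * X')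
          = ((u n)⁻¹ : (H →L[ℂ] H)ˣ).val * (X' * star X') * ((u n)⁻¹ : (H →L[ℂ] H)ˣ).val := by
        rw [star_mul, hs]; simp only [mul_assoc]
      have h2 : (n : ℝ) * ‖((u n)⁻¹ : (H →L[ℂ] H)ˣ).val * X'‖ ^ 2
          = ‖(1 - ((u n)⁻¹ : (H →L[ℂ] H)ˣ).val) * ((u n)⁻¹ : (H →L[ℂ] H)ˣ).val‖ := by
        rw [sq, ← CStarRing.norm_self_mul_star, h1, ← hcT, smul_mul_assoc, norm_smul]
        simp
      rw [h2]
      exact (norm_mul_le _ _).trans (mul_le_one₀ (hcn' n) (norm_nonneg _) (hcn n))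
    have hstrong : ∀ x : H, Filter.Tendsto (fun n => ((u n)⁻¹ : (H →L[ℂ] H)ˣ).val (P x))
        Filter.atTop (nhds 0) := by
      intro x
      rw [Metric.tendsto_atTop]
      intro ε hε
      obtain ⟨_, ⟨z, rfl⟩, hz⟩ := Metric.mem_closure_iff.1 (hPcl x) (ε / 2) (by positivity)
      obtain ⟨N, hN⟩ := exists_nat_gt ((2 * ‖z‖ / ε) ^ 2)
      refine ⟨N, fun n hn => ?_⟩
      rw [dist_zero_right]
      have hnN : (2 * ‖z‖ / ε) ^ 2 < n := hN.trans_le (by exact_mod_cast hn)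
      have h1 : ‖((u n)⁻¹ : (H →L[ℂ] H)ˣ).val (X' z)‖ < ε / 2 := by
        have h2 : ‖((u n)⁻¹ : (H →L[ℂ] H)ˣ).val (X' z)‖
            ≤ ‖((u n)⁻¹ : (H →L[ℂ] H)ˣ).val * X'‖ * ‖z‖ :=
          (((u n)⁻¹ : (H →L[ℂ] H)ˣ).val * X').le_opNorm z
        refine h2.trans_lt ?_
        have h3 := hcX n
        have hnpos : (0 : ℝ) < n := lt_of_le_of_lt (sq_nonneg _) hnN
        rw [div_pow, div_lt_iff₀ (by positivity)] at hnN
        refine lt_of_pow_lt_pow_left₀ 2 (by positivity) ?_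
        have h4 : (n : ℝ) * (‖((u n)⁻¹ : (H →L[ℂ] H)ˣ).val * X'‖ * ‖z‖) ^ 2 ≤ ‖z‖ ^ 2 := by
          rw [mul_pow, ← mul_assoc]
          exact mul_le_of_le_one_left (sq_nonneg _) h3
        have h5 : ‖z‖ ^ 2 < n * (ε / 2) ^ 2 := by nlinarith
        exact lt_of_mul_lt_mul_left (h4.trans_lt h5) hnpos.le
      have h2 : ‖((u n)⁻¹ : (H →L[ℂ] H)ˣ).val (P x - X' z)‖ < ε / 2 := by
        refine (ContinuousLinearMap.le_opNorm _ _).trans_lt ?_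
        rw [dist_eq_norm] at hz
        exact (mul_le_of_le_one_left (norm_nonneg _) (hcn n)).trans_lt hz
      have h3 : ((u n)⁻¹ : (H →L[ℂ] H)ˣ).val (P x) =
          ((u n)⁻¹ : (H →L[ℂ] H)ˣ).val (X' z) + ((u n)⁻¹ : (H →L[ℂ] H)ˣ).val (P x - X' z) := by
        rw [← map_add]; congr 1; abel
      rw [h3]
      refine (norm_add_le _ _).trans_lt ?_
      linarith
    have hstrong' : ∀ x : H, Filter.Tendsto (fun n => (a n : H →L[ℂ] H) x)
        Filter.atTop (nhds (P x)) := by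
      intro x
      have h1 : (fun n => (a n : H →L[ℂ] H) x) =
          fun n => P x - ((u n)⁻¹ : (H →L[ℂ] H)ˣ).val (P x) := by
        funext n
        have h2 := congrArg (fun f : H →L[ℂ] H => f x) (hcP n)
        have h3 : ((u n)⁻¹ : (H →L[ℂ] H)ˣ).val x - ((u n)⁻¹ : (H →L[ℂ] H)ˣ).val (P x)
            = x - P x := by
          rw [← map_sub]; exact h2
        change x - ((u n)⁻¹ : (H →L[ℂ] H)ˣ).val x = _
        rw [sub_eq_iff_eq_add] at h3
        rw [h3]; abel
      rw [h1]
      simpa using (tendsto_const_nhds (x := P x)).sub (hstrong x)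
    have hasa : ∀ n, IsSelfAdjoint (a n : H →L[ℂ] H) := fun n =>
      (IsSelfAdjoint.one _).sub (IsSelfAdjoint.of_nonneg (hu0 n))
    constructor
    · rintro _ ⟨n, rfl⟩
      refine one_sub_le_proj (hu0 n) hP ?_
      have := hcP n
      rw [mul_sub, mul_one, sub_eq_sub_iff_add_eq_add] at this
      rw [sub_mul, one_mul, sub_eq_sub_iff_add_eq_add, add_comm P, this, add_comm]
    · intro B hB
      have hB' : ∀ n, ((B : H →L[ℂ] H) - (a n : H →L[ℂ] H)).IsPositive := fun n => hB ⟨n, rfl⟩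
      change ((B : H →L[ℂ] H) - P).IsPositive
      rw [ContinuousLinearMap.isPositive_def']
      refine ⟨?_, fun x => ?_⟩
      · have h := (hB' 0).isSelfAdjoint.add (hasa 0)
        rw [sub_add_cancel] at h
        exact h.sub hP.isSelfAdjoint
      · have ht : Filter.Tendsto
            (fun n => RCLike.re (inner ℂ ((B : H →L[ℂ] H) x - (a n : H →L[ℂ] H) x) x))
            Filter.atTop (nhds (RCLike.re (inner ℂ ((B : H →L[ℂ] H) x - P x) x))) :=
          (RCLike.continuous_re.tendsto _).comp
            ((tendsto_const_nhds.sub (hstrong' x)).inner tendsto_const_nhds)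
        exact ge_of_tendsto' ht fun n => ((ContinuousLinearMap.isPositive_def'.1 (hB' n)).2 x)
  refine ⟨⟨P, hPM⟩, ⟨Subtype.ext hP.isIdempotentElem, Subtype.ext hP.isSelfAdjoint⟩,
    Subtype.ext hPX, fun Y hY => Subtype.ext (hPmin _ (congrArg Subtype.val hY)), ?_⟩
  have hn := τ.normal (Set.range a) _ (Set.range_nonempty a) ?_ ?_ hlub
  · refine hn.2 ?_
    rintro _ ⟨_, ⟨n, rfl⟩, rfl⟩
    change (τ.toLinearMap (a n)).re ≤ _
    rw [hab]
    exact tr_mono τ (hbG n)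
  · rintro _ ⟨n, rfl⟩
    apply Subtype.ext
    change star (1 - ((u n)⁻¹ : (H →L[ℂ] H)ˣ).val) = _
    rw [star_sub, star_one, (IsSelfAdjoint.of_nonneg (hu0 n)).star_eq]
  · exact directedOn_range.2 hmono.directed_le



/-- The basic neighbourhood of `0` with parameters `ε, δ`: all `A` in the algebra such that
`‖A E‖ ≤ ε` and `τ(1 - E) ≤ δ` for some projection `E` in the algebra. -/
def nbhd (ε δ : ℝ) : Set M.toStarSubalgebra :=
  {A | ∃ E : M.toStarSubalgebra, IsStarProjection E ∧
    ‖((A * E : M.toStarSubalgebra) : H →L[ℂ] H)‖ ≤ ε ∧ (τ.toLinearMap (1 - E)).re ≤ δ}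

theorem nbhd_mono {ε ε' δ δ' : ℝ} (hε : ε ≤ ε') (hδ : δ ≤ δ') : nbhd τ ε δ ⊆ nbhd τ ε' δ' := by
  rintro A ⟨E, hE, h1, h2⟩
  exact ⟨E, hE, h1.trans hε, h2.trans hδ⟩

/-- Two projections have a common upper bound whose trace is at most the sum of the traces. -/
theorem exists_sup_proj {P Q : M.toStarSubalgebra} (hP : IsStarProjection P)
    (hQ : IsStarProjection Q) :
    ∃ R : M.toStarSubalgebra, IsStarProjection R ∧ P * R = P ∧ Q * R = Q ∧
      (τ.toLinearMap R).re ≤ (τ.toLinearMap P).re + (τ.toLinearMap Q).re := by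
  obtain ⟨S, hS, hSX, hSmin, hSt⟩ := exists_range_proj_tr τ (X := (1 - Q) * P) (G := P) hP
    (by rw [mul_assoc, hP.isIdempotentElem.eq])
  have hQS : Q * S = 0 := hSmin Q (by rw [← mul_assoc, hQ.mul_one_sub_self, zero_mul])
  have hSQ : S * Q = 0 := by
    have := congrArg star hQS
    simpa [hQ.isSelfAdjoint.star_eq, hS.isSelfAdjoint.star_eq] using this
  have hR : IsStarProjection (Q + S) := ⟨by
    change (Q + S) * (Q + S) = Q + S
    rw [mul_add, add_mul, add_mul, hQ.isIdempotentElem.eq, hS.isIdempotentElem.eq, hQS, hSQ]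
    simp, hQ.isSelfAdjoint.add hS.isSelfAdjoint⟩
  have hRP : (Q + S) * P = P := by
    have h1 : S * P = (1 - Q) * P := by
      conv_rhs => rw [← hSX]
      rw [← mul_assoc, mul_sub, hSQ, mul_one, sub_zero]
    rw [add_mul, h1, sub_mul, one_mul]; abel
  refine ⟨Q + S, hR, ?_, ?_, ?_⟩
  · have := congrArg star hRP
    rwa [star_mul, hP.isSelfAdjoint.star_eq, hR.isSelfAdjoint.star_eq] at this
  · rw [mul_add, hQS, hQ.isIdempotentElem.eq, add_zero]
  · rw [map_add, Complex.add_re]; linarith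

/-- Two projections have a common lower bound whose complement has trace at most the sum of the
traces of the complements. -/
theorem exists_inf_proj {E F : M.toStarSubalgebra} (hE : IsStarProjection E)
    (hF : IsStarProjection F) :
    ∃ G : M.toStarSubalgebra, IsStarProjection G ∧ E * G = G ∧ F * G = G ∧
      (τ.toLinearMap (1 - G)).re ≤
        (τ.toLinearMap (1 - E)).re + (τ.toLinearMap (1 - F)).re := by
  obtain ⟨R, hR, h1, h2, h3⟩ := exists_sup_proj τ hE.one_sub hF.one_sub
  refine ⟨1 - R, hR.one_sub, ?_, ?_, by simpa using h3⟩
  · have h4 : E * (1 - R) = ((1 - E) * R) - (R - E) := by rw [mul_sub, sub_mul, mul_one, one_mul]; abel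
    rw [h4, h1]; abel
  · have h4 : F * (1 - R) = ((1 - F) * R) - (R - F) := by rw [mul_sub, sub_mul, mul_one, one_mul]; abel
    rw [h4, h2]; abel

theorem norm_proj_le {E : M.toStarSubalgebra} (hE : IsStarProjection E) :
    ‖(E : H →L[ℂ] H)‖ ≤ 1 := by
  have h : IsStarProjection (E : H →L[ℂ] H) :=
    ⟨congrArg Subtype.val hE.isIdempotentElem.eq, congrArg Subtype.val hE.isSelfAdjoint.star_eq⟩
  exact h.norm_le

theorem nbhd_add {ε₁ ε₂ δ₁ δ₂ : ℝ} {A B : M.toStarSubalgebra} (hA : A ∈ nbhd τ ε₁ δ₁)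
    (hB : B ∈ nbhd τ ε₂ δ₂) : A + B ∈ nbhd τ (ε₁ + ε₂) (δ₁ + δ₂) := by
  obtain ⟨E, hE, hAE, hEt⟩ := hA
  obtain ⟨F, hF, hBF, hFt⟩ := hB
  obtain ⟨G, hG, h1, h2, h3⟩ := exists_inf_proj τ hE hF
  refine ⟨G, hG, ?_, h3.trans (add_le_add hEt hFt)⟩
  have h4 : (A + B) * G = (A * E) * G + (B * F) * G := by
    rw [mul_assoc, mul_assoc, h1, h2, add_mul]
  rw [h4]
  refine (norm_add_le ((A * E : M.toStarSubalgebra) * G : H →L[ℂ] H)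
    ((B * F : M.toStarSubalgebra) * G : H →L[ℂ] H)).trans ?_
  have hG1 := norm_proj_le hG
  exact add_le_add
    ((norm_mul_le _ _).trans ((mul_le_of_le_one_right (norm_nonneg _) hG1).trans hAE))
    ((norm_mul_le _ _).trans ((mul_le_of_le_one_right (norm_nonneg _) hG1).trans hBF))

theorem nbhd_mul {ε₁ ε₂ δ₁ δ₂ : ℝ} {A B : M.toStarSubalgebra} (hA : A ∈ nbhd τ ε₁ δ₁)
    (hB : B ∈ nbhd τ ε₂ δ₂) : A * B ∈ nbhd τ (ε₁ * ε₂) (δ₁ + δ₂) := by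
  obtain ⟨E, hE, hAE, hEt⟩ := hA
  obtain ⟨F, hF, hBF, hFt⟩ := hB
  obtain ⟨P, hP, hPX, -, hPt⟩ := exists_range_proj_tr τ (X := star B * (1 - E)) hE.one_sub
    (by rw [mul_assoc, hE.one_sub.isIdempotentElem.eq])
  have hXP : (1 - E) * B * (1 - P) = 0 := by
    have := congrArg star hPX
    simp only [star_mul, star_star, hP.isSelfAdjoint.star_eq,
      hE.one_sub.isSelfAdjoint.star_eq] at this
    rw [mul_sub, this]; simp
  obtain ⟨G, hG, h1, h2, h3⟩ := exists_inf_proj τ hF hP.one_sub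
  refine ⟨G, hG, ?_, h3.trans ?_⟩
  · have h4 : B * G = E * (B * G) := by
      have h5 : (1 - E) * (B * G) = 0 := by
        rw [← h2, ← mul_assoc, ← mul_assoc, hXP, zero_mul]
      rwa [sub_mul, one_mul, sub_eq_zero] at h5
    have h6 : A * B * G = (A * E) * ((B * F) * G) := by
      rw [mul_assoc, h4, mul_assoc B, h1, mul_assoc]
    rw [h6]
    have hG1 := norm_proj_le hG
    refine (norm_mul_le ((A * E : M.toStarSubalgebra) : H →L[ℂ] H)
      ((B * F : M.toStarSubalgebra) * G : H →L[ℂ] H)).trans ?_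
    have h7 : ‖((B * F : M.toStarSubalgebra) * G : H →L[ℂ] H)‖ ≤ ε₂ :=
      (norm_mul_le _ _).trans ((mul_le_of_le_one_right (norm_nonneg _) hG1).trans hBF)
    exact mul_le_mul hAE h7 (norm_nonneg _) ((norm_nonneg _).trans hAE)
  · rw [sub_sub_cancel]; linarith

theorem nbhd_star {ε δ : ℝ} {A : M.toStarSubalgebra} (hA : A ∈ nbhd τ ε δ) :
    star A ∈ nbhd τ ε δ := by
  obtain ⟨E, hE, hAE, hEt⟩ := hA
  obtain ⟨P, hP, hPX, -, hPt⟩ := exists_range_proj_tr τ (X := A * (1 - E)) hE.one_sub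
    (by rw [mul_assoc, hE.one_sub.isIdempotentElem.eq])
  refine ⟨1 - P, hP.one_sub, ?_, by rw [sub_sub_cancel]; linarith⟩
  have h1 : (1 - P) * A = (1 - P) * (A * E) := by
    have h2 : (1 - P) * (A * (1 - E)) = 0 := by rw [sub_mul, one_mul, hPX, sub_self]
    rwa [mul_sub, mul_one, mul_sub, sub_eq_zero] at h2
  have h3 : star A * (1 - P) = star ((1 - P) * (A * E)) := by
    rw [← h1, star_mul, hP.one_sub.isSelfAdjoint.star_eq]
  rw [h3]
  change ‖star ((((1 - P : M.toStarSubalgebra) : H →L[ℂ] H)) *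
    ((A * E : M.toStarSubalgebra) : H →L[ℂ] H))‖ ≤ ε
  rw [norm_star]
  exact (norm_mul_le _ _).trans
    ((mul_le_of_le_one_left (norm_nonneg _) (norm_proj_le hP.one_sub)).trans hAE)

theorem mem_nbhd_of_norm_le {ε δ : ℝ} (hδ : 0 ≤ δ) {A : M.toStarSubalgebra}
    (hA : ‖(A : H →L[ℂ] H)‖ ≤ ε) : A ∈ nbhd τ ε δ :=
  ⟨1, IsStarProjection.one _, by rwa [mul_one], by simpa using hδ⟩

open scoped Pointwise in
/-- The sets `nbhd τ ε δ` with `ε, δ > 0` form a basis of neighbourhoods of `0` for a (unique)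
ring topology. -/
@[reducible]
def filterBasis : RingFilterBasis M.toStarSubalgebra where
  sets := {U | ∃ ε > 0, ∃ δ > 0, U = nbhd τ ε δ}
  nonempty := ⟨_, 1, one_pos, 1, one_pos, rfl⟩
  inter_sets := by
    rintro _ _ ⟨ε, hε, δ, hδ, rfl⟩ ⟨ε', hε', δ', hδ', rfl⟩
    exact ⟨_, ⟨min ε ε', lt_min hε hε', min δ δ', lt_min hδ hδ', rfl⟩, Set.subset_inter
      (nbhd_mono τ (min_le_left _ _) (min_le_left _ _))
      (nbhd_mono τ (min_le_right _ _) (min_le_right _ _))⟩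
  zero' := by
    rintro _ ⟨ε, hε, δ, hδ, rfl⟩
    exact mem_nbhd_of_norm_le τ hδ.le (by simpa using hε.le)
  add' := by
    rintro _ ⟨ε, hε, δ, hδ, rfl⟩
    refine ⟨_, ⟨ε / 2, half_pos hε, δ / 2, half_pos hδ, rfl⟩, ?_⟩
    rintro _ ⟨A, hA, B, hB, rfl⟩
    simpa using nbhd_add τ hA hB
  neg' := by
    rintro _ ⟨ε, hε, δ, hδ, rfl⟩
    refine ⟨_, ⟨ε, hε, δ, hδ, rfl⟩, ?_⟩
    rintro A ⟨E, hE, h1, h2⟩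
    refine ⟨E, hE, ?_, h2⟩
    rw [neg_mul]
    exact (norm_neg ((A * E : M.toStarSubalgebra) : H →L[ℂ] H)).trans_le h1
  conj' := by
    rintro x _ ⟨ε, hε, δ, hδ, rfl⟩
    exact ⟨_, ⟨ε, hε, δ, hδ, rfl⟩, fun A hA => by simpa using hA⟩
  mul' := by
    rintro _ ⟨ε, hε, δ, hδ, rfl⟩
    refine ⟨_, ⟨Real.sqrt ε, Real.sqrt_pos.2 hε, δ / 2, half_pos hδ, rfl⟩, ?_⟩
    rintro _ ⟨A, hA, B, hB, rfl⟩
    simpa [Real.mul_self_sqrt hε.le] using nbhd_mul τ hA hB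
  mul_left' := by
    rintro x _ ⟨ε, hε, δ, hδ, rfl⟩
    have hx : 0 < ‖(x : H →L[ℂ] H)‖ + 1 := by positivity
    refine ⟨_, ⟨ε / (‖(x : H →L[ℂ] H)‖ + 1), div_pos hε hx, δ / 2, half_pos hδ, rfl⟩, ?_⟩
    intro A hA
    have h := nbhd_mul τ (mem_nbhd_of_norm_le τ (half_pos hδ).le
      (le_add_of_nonneg_right zero_le_one : ‖(x : H →L[ℂ] H)‖ ≤ ‖(x : H →L[ℂ] H)‖ + 1)) hA
    rwa [mul_div_cancel₀ _ hx.ne', add_halves] at h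
  mul_right' := by
    rintro x _ ⟨ε, hε, δ, hδ, rfl⟩
    have hx : 0 < ‖(x : H →L[ℂ] H)‖ + 1 := by positivity
    refine ⟨_, ⟨ε / (‖(x : H →L[ℂ] H)‖ + 1), div_pos hε hx, δ / 2, half_pos hδ, rfl⟩, ?_⟩
    intro A hA
    have h := nbhd_mul τ hA (mem_nbhd_of_norm_le τ (half_pos hδ).le
      (le_add_of_nonneg_right zero_le_one : ‖(x : H →L[ℂ] H)‖ ≤ ‖(x : H →L[ℂ] H)‖ + 1))
    rwa [div_mul_cancel₀ _ hx.ne', add_halves] at h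

/-- The von Neumann algebra `M`, as a complex `*`-algebra, to be equipped with the measure topology
of `τ` (a type synonym, so that the operator norm topology does not interfere). -/
def MeasureAlgebra (_τ : FaithfulNormalTracialState M) : Type _ := M.toStarSubalgebra

namespace MeasureAlgebra

instance : Ring (MeasureAlgebra τ) := inferInstanceAs (Ring M.toStarSubalgebra)
instance : StarRing (MeasureAlgebra τ) := inferInstanceAs (StarRing M.toStarSubalgebra)
instance : Algebra ℂ (MeasureAlgebra τ) := inferInstanceAs (Algebra ℂ M.toStarSubalgebra)
instance : StarModule ℂ (MeasureAlgebra τ) := inferInstanceAs (StarModule ℂ M.toStarSubalgebra)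

/-- The measure topology, with its translation invariant uniform structure. -/
instance : UniformSpace (MeasureAlgebra τ) := (filterBasis τ).toAddGroupFilterBasis.uniformSpace

instance : IsUniformAddGroup (MeasureAlgebra τ) :=
  (filterBasis τ).toAddGroupFilterBasis.isUniformAddGroup

instance : IsTopologicalRing (MeasureAlgebra τ) := (filterBasis τ).isTopologicalRing

variable {τ} in
/-- The bounded operator underlying an element of the von Neumann algebra. -/
def toOperator (A : MeasureAlgebra τ) : H →L[ℂ] H := Subtype.val (p := (· ∈ M.toStarSubalgebra)) A

theorem nhds_zero_hasBasis : (nhds (0 : MeasureAlgebra τ)).HasBasis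
    (fun p : ℝ × ℝ => 0 < p.1 ∧ 0 < p.2) (fun p => nbhd τ p.1 p.2) := by
  refine ⟨fun t => ?_⟩
  refine ((filterBasis τ).toAddGroupFilterBasis.nhds_zero_hasBasis.mem_iff).trans ?_
  constructor
  · rintro ⟨_, ⟨ε, hε, δ, hδ, rfl⟩, h⟩
    exact ⟨(ε, δ), ⟨hε, hδ⟩, h⟩
  · rintro ⟨⟨ε, δ⟩, ⟨hε, hδ⟩, h⟩
    exact ⟨_, ⟨ε, hε, δ, hδ, rfl⟩, h⟩

theorem uniformContinuous_star : UniformContinuous (star : MeasureAlgebra τ → MeasureAlgebra τ) := by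
  refine uniformContinuous_of_continuousAt_zero (starAddEquiv : MeasureAlgebra τ ≃+ _) ?_
  change Filter.Tendsto star (nhds (0 : MeasureAlgebra τ)) (nhds (star 0))
  rw [star_zero]
  refine ((nhds_zero_hasBasis τ).tendsto_iff (nhds_zero_hasBasis τ)).2 fun p hp => ?_
  exact ⟨p, hp, fun A hA => nbhd_star τ hA⟩

instance : UniformContinuousConstSMul ℂ (MeasureAlgebra τ) where
  uniformContinuous_const_smul c := by
    have h : (fun A : MeasureAlgebra τ => c • A) =
        AddMonoidHom.mulLeft (algebraMap ℂ (MeasureAlgebra τ) c) := by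
      funext A; exact Algebra.smul_def c A
    rw [h]
    exact uniformContinuous_addMonoidHom_of_continuous (continuous_const_mul _)

end MeasureAlgebra

/-- The completion of the von Neumann algebra in the measure topology. Addition, multiplication and
scalar multiplication are the continuous extensions of those of the algebra. -/
abbrev MeasureCompletion (τ : FaithfulNormalTracialState M) : Type _ :=
  UniformSpace.Completion (MeasureAlgebra τ)

namespace MeasureCompletion

open UniformSpace

/-- The adjoint on the completion: the continuous extension of the adjoint. -/
instance : Star (MeasureCompletion τ) := ⟨Completion.map star⟩

theorem coe_star (A : MeasureAlgebra τ) :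
    ((star A : MeasureAlgebra τ) : MeasureCompletion τ) = star (A : MeasureCompletion τ) :=
  (Completion.map_coe (MeasureAlgebra.uniformContinuous_star τ) A).symm

instance : ContinuousStar (MeasureCompletion τ) := ⟨Completion.continuous_map⟩

instance : StarRing (MeasureCompletion τ) where
  star_involutive A := by
    refine Completion.induction_on A
      (isClosed_eq (continuous_star.comp continuous_star) continuous_id) fun a => ?_
    rw [← coe_star, ← coe_star, star_star]
  star_mul A B := by
    refine Completion.induction_on₂ A B (isClosed_eq (by fun_prop) (by fun_prop)) fun a b => ?_
    rw [← Completion.coe_mul, ← coe_star, star_mul, Completion.coe_mul, coe_star, coe_star]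
  star_add A B := by
    refine Completion.induction_on₂ A B (isClosed_eq (by fun_prop) (by fun_prop)) fun a b => ?_
    rw [← Completion.coe_add, ← coe_star, star_add, Completion.coe_add, coe_star, coe_star]

instance : StarModule ℂ (MeasureCompletion τ) where
  star_smul c A := by
    refine Completion.induction_on A (isClosed_eq
      (continuous_star.comp (continuous_const_smul c))
      ((continuous_const_smul (star c)).comp continuous_star)) fun a => ?_
    rw [← Completion.coe_smul, ← coe_star, star_smul, Completion.coe_smul, coe_star]

end MeasureCompletion

/-- The set of self-adjoint elements of the von Neumann algebra. -/
def selfAdjointPart : Set (MeasureAlgebra τ) := {A | IsSelfAdjoint A}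

/-- The set of positive operators in the von Neumann algebra. -/
def positivePart : Set (MeasureAlgebra τ) := {A | A.toOperator.IsPositive}

/-- The closure, in the measure completion, of the set of positive operators. -/
def completedPositivePart : Set (MeasureCompletion τ) :=
  closure ((fun A : MeasureAlgebra τ => (A : MeasureCompletion τ)) '' positivePart τ)

end MeasureTopology

end

noncomputable section

namespace MeasureTopology

variable {H : Type*} [NormedAddCommGroup H] [InnerProductSpace ℂ H] [CompleteSpace H]

/-! Everything about self-adjointness is soft: the adjoint is uniformly continuous in measure, and
`X ↦ (X + X*)/2` is a continuous map fixing the self-adjoint elements. The content lies in two facts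
about positivity.

Positivity survives limits in measure inside `M`. If `A` is self-adjoint and `B ≥ 0` is close to `A`
in measure, then `EAE` is almost positive for a projection `E` whose complement has small trace. The
trace pairing of `1 - E` with a bounded operator is small, so `τ(XAX) ≥ 0` for every self-adjoint
`X` in `M` (`re_tr_conj_nonneg`). Taking for `X` the negative part `N` of `A` gives `-τ(N³) ≥ 0`,
and faithfulness forces `N = 0`.

The closed cone in the completion is salient. An element of the completion is not an operator here,
so the argument stays in `M`: if `A` and `-A` are limits of positive `a` and `b`, then `a + b → 0`
in measure. Since `0 ≤ a ≤ a + b`, domination (`mem_nbhd_of_nonneg_of_le`) gives `a → 0`, whence `A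
= 0`.

The remaining cone, algebra and order axioms follow by continuity and density. -/

/-! ### Functional calculus inside the algebra, by the double commutant theorem -/

theorem cfcₙ_real_mem (M : VonNeumannAlgebra H) {A : H →L[ℂ] H} (hA : A ∈ M) (f : ℝ → ℝ) :
    cfcₙ f A ∈ M := by
  rw [← VonNeumannAlgebra.commutant_commutant M, VonNeumannAlgebra.mem_commutant_iff]
  intro g hg
  have h : Commute A g := VonNeumannAlgebra.mem_commutant_iff.1 hg A hA
  -- Outside the domain of the functional calculus, for instance for `A` not self-adjoint, `cfcₙ f
  -- A` takes the default value `0`, so commutation needs no assumption on `A` or `f`.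
  exact (h.cfcₙ_real f).symm

theorem sqrt_mem (M : VonNeumannAlgebra H) {A : H →L[ℂ] H} (hA : A ∈ M) :
    CFC.sqrt A ∈ M := by
  rw [← VonNeumannAlgebra.commutant_commutant M, VonNeumannAlgebra.mem_commutant_iff]
  intro g hg
  have h : Commute A g := VonNeumannAlgebra.mem_commutant_iff.1 hg A hA
  exact (h.cfcₙ_nnreal _).symm

variable {M : VonNeumannAlgebra H} (τ : FaithfulNormalTracialState M)

/-! ### Trace estimates -/

/-- The positive element `a + ‖a‖ • 1` has real trace, and the shift contributes the real number
`‖a‖`. -/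
theorem im_tr_eq_zero {a : M.toStarSubalgebra} (ha : IsSelfAdjoint a) :
    (τ.toLinearMap a).im = 0 := by
  have ha' : IsSelfAdjoint (a : H →L[ℂ] H) := congrArg Subtype.val ha
  have h1 : (0 : M.toStarSubalgebra) ≤ a + ((‖(a : H →L[ℂ] H)‖ : ℝ) : ℂ) • 1 := by
    have := ha'.neg_algebraMap_norm_le_self
    rw [neg_le_iff_add_nonneg, Algebra.algebraMap_eq_smul_one] at this
    exact this
  have h2 := (Complex.le_def.1 (τ.nonneg _ h1)).2
  rw [map_add, map_smul, τ.map_one] at h2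
  simpa using h2.symm

theorem re_tr_star (a : M.toStarSubalgebra) :
    (τ.toLinearMap (star a)).re = (τ.toLinearMap a).re := by
  -- The imaginary part of the trace of this self-adjoint element is the real part of `τ(a - a*)`.
  have h : IsSelfAdjoint (Complex.I • (a - star a)) := by
    rw [IsSelfAdjoint, star_smul, star_sub, star_star, ← neg_sub a, smul_neg, ← neg_smul]
    simp
  have h1 := im_tr_eq_zero τ h
  rw [map_smul, map_sub] at h1
  simp [sub_eq_zero] at h1
  exact h1.symm

/-- By traciality `τ(PY) = τ(PYP)`, and `PYP ≤ ‖Y‖ P`. -/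
theorem re_tr_proj_mul_le_of_isSelfAdjoint {P Y : M.toStarSubalgebra} (hP : IsStarProjection P)
    (hY : IsSelfAdjoint Y) :
    (τ.toLinearMap (P * Y)).re ≤ ‖(Y : H →L[ℂ] H)‖ * (τ.toLinearMap P).re := by
  have hY' : IsSelfAdjoint (Y : H →L[ℂ] H) := congrArg Subtype.val hY
  have hPs : star (P : H →L[ℂ] H) = P := congrArg Subtype.val hP.isSelfAdjoint.star_eq
  have hPi : (P : H →L[ℂ] H) * P = P := congrArg Subtype.val hP.isIdempotentElem.eq
  have h1 : τ.toLinearMap (P * Y) = τ.toLinearMap (P * Y * P) := by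
    rw [τ.tracial (P * Y), ← mul_assoc, hP.isIdempotentElem.eq]
  have h2 : P * Y * P ≤ ((‖(Y : H →L[ℂ] H)‖ : ℝ) : ℂ) • P := by
    have h3 := star_right_conjugate_le_conjugate hY'.le_algebraMap_norm_self (P : H →L[ℂ] H)
    rw [hPs, Algebra.algebraMap_eq_smul_one, mul_smul_comm, smul_mul_assoc, mul_one, hPi] at h3
    exact h3
  have h4 := tr_mono τ h2
  rw [map_smul, ← h1] at h4
  simpa using h4

/-- The trace pairing of a projection with an operator is bounded by the norm of the operator. -/
theorem re_tr_proj_mul_le {P : M.toStarSubalgebra} (hP : IsStarProjection P)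
    (Y : M.toStarSubalgebra) :
    (τ.toLinearMap (P * Y)).re ≤ ‖(Y : H →L[ℂ] H)‖ * (τ.toLinearMap P).re := by
  -- Hence pairing `P` with `Y + Y*` doubles the real part, while the norm at most doubles; this
  -- reduces to the self-adjoint case.
  have h1 : (τ.toLinearMap (P * star Y)).re = (τ.toLinearMap (P * Y)).re := by
    rw [← re_tr_star, star_mul, star_star, hP.isSelfAdjoint.star_eq, τ.tracial]
  have h2 := re_tr_proj_mul_le_of_isSelfAdjoint τ hP (IsSelfAdjoint.add_star_self Y)
  rw [mul_add, map_add, Complex.add_re, h1] at h2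
  have h3 : ‖((Y + star Y : M.toStarSubalgebra) : H →L[ℂ] H)‖ ≤ 2 * ‖(Y : H →L[ℂ] H)‖ := by
    refine (norm_add_le (Y : H →L[ℂ] H) (star (Y : H →L[ℂ] H))).trans ?_
    rw [norm_star]; linarith
  have h4 : 0 ≤ (τ.toLinearMap P).re := (Complex.le_def.1 (τ.nonneg _ (by
    have : (0 : H →L[ℂ] H) ≤ star (P : H →L[ℂ] H) * P := star_mul_self_nonneg _
    have h5 : star (P : H →L[ℂ] H) * P = P := by
      rw [show star (P : H →L[ℂ] H) = P from congrArg Subtype.val hP.isSelfAdjoint.star_eq]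
      exact congrArg Subtype.val hP.isIdempotentElem.eq
    rw [h5] at this
    exact this))).1
  nlinarith

theorem neg_le_re_tr_proj_mul {P : M.toStarSubalgebra} (hP : IsStarProjection P)
    (Y : M.toStarSubalgebra) :
    -(‖(Y : H →L[ℂ] H)‖ * (τ.toLinearMap P).re) ≤ (τ.toLinearMap (P * Y)).re := by
  have h := re_tr_proj_mul_le τ hP (-Y)
  have h2 : ‖((-Y : M.toStarSubalgebra) : H →L[ℂ] H)‖ = ‖(Y : H →L[ℂ] H)‖ := norm_neg _
  rw [h2, mul_neg, map_neg, Complex.neg_re] at h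
  linarith

theorem eq_zero_of_re_tr_le {A : M.toStarSubalgebra} (hA : 0 ≤ A)
    (h : (τ.toLinearMap A).re ≤ 0) : A = 0 := by
  have h1 := Complex.le_def.1 (τ.nonneg A hA)
  refine τ.faithful A hA (Complex.ext (le_antisymm h h1.1) h1.2.symm)

theorem nonpos_of_forall_le_mul {x C : ℝ} (h : ∀ η > 0, x ≤ η * C) : x ≤ 0 := by
  have : Filter.Tendsto (fun η : ℝ => η * C) (nhdsWithin 0 (Set.Ioi 0)) (nhds 0) := by
    have h1 : Filter.Tendsto (fun η : ℝ => η * C) (nhds 0) (nhds (0 * C)) :=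
      (continuous_id.mul continuous_const).tendsto 0
    rw [zero_mul] at h1
    exact h1.mono_left nhdsWithin_le_nhds
  exact ge_of_tendsto this (Filter.eventually_of_mem self_mem_nhdsWithin h)

/-! ### Separation, positivity of limits, and domination in measure -/

theorem eq_zero_of_forall_mem_nbhd {A : M.toStarSubalgebra} (h : ∀ η > 0, A ∈ nbhd τ η η) :
    A = 0 := by
  have hA : star A * A = 0 := by
    refine eq_zero_of_re_tr_le τ ?_ ?_
    · have : (0 : H →L[ℂ] H) ≤ star (A : H →L[ℂ] H) * A := star_mul_self_nonneg _
      exact this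
    -- Split `τ(A*A) = τ(A*AE) + τ((1 - E)A*A)`: the first term is at most `‖A‖ η` because `‖AE‖ ≤
    -- η`, the second at most `‖A‖² η` because `τ(1 - E) ≤ η`.
    refine nonpos_of_forall_le_mul (C := ‖(A : H →L[ℂ] H)‖ + ‖(A : H →L[ℂ] H)‖ ^ 2) fun η hη => ?_
    obtain ⟨E, hE, hAE, hEt⟩ := h η hη
    have h1 : τ.toLinearMap (star A * A) =
        τ.toLinearMap (1 * (star A * (A * E))) + τ.toLinearMap ((1 - E) * (star A * A)) := by
      rw [τ.tracial (1 - E), ← map_add]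
      congr 1
      simp only [one_mul, mul_sub, mul_one, mul_assoc]
      abel
    have h2 := re_tr_proj_mul_le τ (IsStarProjection.one _) (star A * (A * E))
    have h3 := re_tr_proj_mul_le τ hE.one_sub (star A * A)
    have h4 : ‖((star A * (A * E) : M.toStarSubalgebra) : H →L[ℂ] H)‖
        ≤ ‖(A : H →L[ℂ] H)‖ * η := by
      refine (norm_mul_le (star (A : H →L[ℂ] H)) ((A * E : M.toStarSubalgebra) : H →L[ℂ] H)).trans ?_
      rw [norm_star]
      gcongr
    have h5 : ‖((star A * A : M.toStarSubalgebra) : H →L[ℂ] H)‖ = ‖(A : H →L[ℂ] H)‖ ^ 2 := by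
      rw [sq]; exact CStarRing.norm_star_mul_self
    rw [τ.map_one, Complex.one_re, mul_one] at h2
    rw [h5] at h3
    rw [h1, Complex.add_re]
    have h6 : ‖(A : H →L[ℂ] H)‖ ^ 2 * (τ.toLinearMap (1 - E)).re ≤ ‖(A : H →L[ℂ] H)‖ ^ 2 * η := by
      gcongr
    linarith
  have h2 : star (A : H →L[ℂ] H) * A = 0 := congrArg Subtype.val hA
  exact Subtype.ext (CStarRing.star_mul_self_eq_zero_iff _ |>.1 h2)

/-- The self-adjoint operator `E(A - B)E` has norm at most `ε`, so it is at least `-ε`; adding `EBE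
≥ 0` preserves the bound. -/
theorem neg_smul_le_compression {A B E : M.toStarSubalgebra} {ε : ℝ} (hA : IsSelfAdjoint A)
    (hB : 0 ≤ B) (hE : IsStarProjection E)
    (h : ‖(((A - B) * E : M.toStarSubalgebra) : H →L[ℂ] H)‖ ≤ ε) :
    -((ε : ℂ) • (1 : H →L[ℂ] H)) ≤ E * A * E := by
  set A' : H →L[ℂ] H := A.1
  set B' : H →L[ℂ] H := B.1
  set E' : H →L[ℂ] H := E.1
  have hA' : IsSelfAdjoint A' := congrArg Subtype.val hA
  have hB' : 0 ≤ B' := hB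
  have hEs : star E' = E' := congrArg Subtype.val hE.isSelfAdjoint.star_eq
  have hsa : IsSelfAdjoint (E' * (A' - B') * E') := by
    have := (hA'.sub (IsSelfAdjoint.of_nonneg hB')).conjugate E'
    rwa [hEs] at this
  have hn : ‖E' * (A' - B') * E'‖ ≤ ε := by
    rw [mul_assoc]
    exact (norm_mul_le _ _).trans ((mul_le_of_le_one_left (norm_nonneg _) (norm_proj_le hE)).trans h)
  have h1 := hsa.neg_algebraMap_norm_le_self
  have h2 : ((‖E' * (A' - B') * E'‖ : ℝ) : ℂ) • (1 : H →L[ℂ] H) ≤ (ε : ℂ) • (1 : H →L[ℂ] H) :=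
    smul_le_smul_of_nonneg_right (by exact_mod_cast hn) zero_le_one
  have h3 : 0 ≤ E' * B' * E' := by
    have := star_right_conjugate_nonneg hB' E'
    rwa [hEs] at this
  rw [Algebra.algebraMap_eq_smul_one] at h1
  have h4 : E' * (A' - B') * E' = E' * A' * E' - E' * B' * E' := by rw [mul_sub, sub_mul]
  calc _ ≤ _ := neg_le_neg h2
    _ ≤ E' * (A' - B') * E' := h1
    _ ≤ E' * A' * E' := by rw [h4]; exact sub_le_self _ h3

/-- A self-adjoint operator which is a limit in measure of positive operators has nonnegative
compressions in trace. -/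
theorem re_tr_conj_nonneg {A X : M.toStarSubalgebra} (hA : IsSelfAdjoint A)
    (hX : IsSelfAdjoint X)
    (h : ∀ η > 0, ∃ B : M.toStarSubalgebra, 0 ≤ B ∧ A - B ∈ nbhd τ η η) :
    0 ≤ (τ.toLinearMap (X * A * X)).re := by
  rw [← neg_nonpos]
  -- The term `τ(X²)` comes from the compression `EAE ≥ -η`; the two copies of `‖A‖ ‖X‖²` bound the
  -- two corrections involving `1 - E`.
  refine nonpos_of_forall_le_mul (C := (τ.toLinearMap (X * X)).re +
    2 * (‖(A : H →L[ℂ] H)‖ * ‖(X : H →L[ℂ] H)‖ ^ 2)) fun η hη => ?_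
  obtain ⟨B, hB, E, hE, hAE, hEt⟩ := h η hη
  have hXs : star (X : H →L[ℂ] H) = X := congrArg Subtype.val hX.star_eq
  have h1 : -((η : ℂ) • (X * X)) ≤ X * (E * A * E) * X := by
    have := star_right_conjugate_le_conjugate (neg_smul_le_compression hA hB hE hAE)
      (X : H →L[ℂ] H)
    rw [hXs, mul_neg, neg_mul, mul_smul_comm, smul_mul_assoc, mul_one] at this
    exact this
  have h2 := tr_mono τ h1
  rw [map_neg, map_smul] at h2
  -- Uses `A = EAE + (1 - E)AE + A(1 - E)`, with traciality moving `1 - E` to the front so that the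
  -- trace pairing bound applies.
  have h3 : τ.toLinearMap (X * A * X) = τ.toLinearMap (X * (E * A * E) * X) +
      τ.toLinearMap ((1 - E) * (A * E * (X * X))) + τ.toLinearMap ((1 - E) * (X * X * A)) := by
    have e1 : τ.toLinearMap ((1 - E) * (A * E * (X * X))) =
        τ.toLinearMap (X * ((1 - E) * (A * E)) * X) := by
      rw [τ.tracial (X * _) X]
      rw [← mul_assoc X X, τ.tracial (X * X)]
      simp only [mul_assoc]
    have e2 : τ.toLinearMap ((1 - E) * (X * X * A)) = τ.toLinearMap (X * (A * (1 - E)) * X) := by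
      rw [τ.tracial (X * _) X, τ.tracial (1 - E)]
      simp only [mul_assoc]
    rw [e1, e2, ← map_add, ← map_add]
    congr 1
    noncomm_ring
  have h4 := neg_le_re_tr_proj_mul τ hE.one_sub (A * E * (X * X))
  have h5 := neg_le_re_tr_proj_mul τ hE.one_sub (X * X * A)
  have hXX : ‖(X : H →L[ℂ] H) * X‖ ≤ ‖(X : H →L[ℂ] H)‖ ^ 2 := by rw [sq]; exact norm_mul_le _ _
  have h6 : ‖((A * E * (X * X) : M.toStarSubalgebra) : H →L[ℂ] H)‖ ≤
      ‖(A : H →L[ℂ] H)‖ * ‖(X : H →L[ℂ] H)‖ ^ 2 := by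
    refine (norm_mul_le ((A : H →L[ℂ] H) * E) ((X : H →L[ℂ] H) * X)).trans ?_
    gcongr
    exact (norm_mul_le _ _).trans (mul_le_of_le_one_right (norm_nonneg _) (norm_proj_le hE))
  have h7 : ‖((X * X * A : M.toStarSubalgebra) : H →L[ℂ] H)‖ ≤
      ‖(A : H →L[ℂ] H)‖ * ‖(X : H →L[ℂ] H)‖ ^ 2 := by
    refine (norm_mul_le ((X : H →L[ℂ] H) * X) (A : H →L[ℂ] H)).trans ?_
    rw [mul_comm]
    gcongr
  have h8 : ‖((A * E * (X * X) : M.toStarSubalgebra) : H →L[ℂ] H)‖ * (τ.toLinearMap (1 - E)).re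
      ≤ ‖(A : H →L[ℂ] H)‖ * ‖(X : H →L[ℂ] H)‖ ^ 2 * η :=
    (mul_le_mul_of_nonneg_left hEt (norm_nonneg _)).trans (mul_le_mul_of_nonneg_right h6 hη.le)
  have h9 : ‖((X * X * A : M.toStarSubalgebra) : H →L[ℂ] H)‖ * (τ.toLinearMap (1 - E)).re
      ≤ ‖(A : H →L[ℂ] H)‖ * ‖(X : H →L[ℂ] H)‖ ^ 2 * η :=
    (mul_le_mul_of_nonneg_left hEt (norm_nonneg _)).trans (mul_le_mul_of_nonneg_right h7 hη.le)
  rw [h3, Complex.add_re, Complex.add_re]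
  simp only [smul_eq_mul, Complex.neg_re, Complex.re_ofReal_mul] at h2
  linarith

/-- Test `A` against its own negative part `N`: since `NAN = -N³`, nonnegativity of `τ(NAN)` and
faithfulness kill `N³`, hence `N`. -/
theorem nonneg_of_forall_sub_mem_nbhd {A : M.toStarSubalgebra} (hA : IsSelfAdjoint A)
    (h : ∀ η > 0, ∃ B : M.toStarSubalgebra, 0 ≤ B ∧ A - B ∈ nbhd τ η η) : 0 ≤ A := by
  set A' : H →L[ℂ] H := A.1
  have hA' : IsSelfAdjoint A' := congrArg Subtype.val hA
  have hN0 : 0 ≤ A'⁻ := CFC.negPart_nonneg A'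
  have hNs : star A'⁻ = A'⁻ := (IsSelfAdjoint.of_nonneg hN0).star_eq
  let N : M.toStarSubalgebra := ⟨A'⁻, cfcₙ_real_mem M A.2 _⟩
  have hN : IsSelfAdjoint N := Subtype.ext hNs
  have h1 := re_tr_conj_nonneg τ hA hN h
  have h2 : A'⁻ * A' * A'⁻ = -(A'⁻ * A'⁻ * A'⁻) := by
    have h := congrArg (fun X => A'⁻ * X * A'⁻) (CFC.posPart_sub_negPart A' hA')
    simpa only [mul_sub, CFC.negPart_mul_posPart, zero_sub, neg_mul] using h.symm
  have h3 : N * A * N = -(N * N * N) := Subtype.ext h2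
  have h4 : N * N * N = 0 := by
    refine eq_zero_of_re_tr_le τ ?_ ?_
    · have := star_right_conjugate_nonneg hN0 A'⁻
      rw [hNs] at this
      exact this
    · rw [h3, map_neg, Complex.neg_re] at h1
      linarith
  have h5 : A'⁻ * A'⁻ * A'⁻ = 0 := congrArg Subtype.val h4
  have h6 : A'⁻ * A'⁻ = 0 := by
    rw [← CStarRing.star_mul_self_eq_zero_iff, star_mul, hNs, ← mul_assoc, h5, zero_mul]
  have h7 : A'⁻ = 0 := by rw [← CStarRing.star_mul_self_eq_zero_iff, hNs, h6]
  have h8 : A' = A'⁺ := by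
    have h := CFC.posPart_sub_negPart A' hA'
    rw [h7, sub_zero] at h
    exact h.symm
  have h9 : 0 ≤ A' := by rw [h8]; exact CFC.posPart_nonneg A'
  exact h9

/-- Operators dominated by an operator small in measure are small in measure. -/
theorem mem_nbhd_of_nonneg_of_le {A C : M.toStarSubalgebra} {ε δ : ℝ} (hA : 0 ≤ A) (hAC : A ≤ C)
    (hC : C ∈ nbhd τ ε δ) : A ∈ nbhd τ ε (δ + δ) := by
  obtain ⟨E, hE, hCE, hEt⟩ := hC
  set A' : H →L[ℂ] H := A.1
  have hA' : 0 ≤ A' := hA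
  have hε : 0 ≤ ε := (norm_nonneg _).trans hCE
  have hEs : star (E : H →L[ℂ] H) = E := congrArg Subtype.val hE.isSelfAdjoint.star_eq
  let S : M.toStarSubalgebra := ⟨CFC.sqrt A', sqrt_mem M A.2⟩
  have hSs : star (CFC.sqrt A') = CFC.sqrt A' :=
    (IsSelfAdjoint.of_nonneg (CFC.sqrt_nonneg A')).star_eq
  have hSS : CFC.sqrt A' * CFC.sqrt A' = A' := CFC.sqrt_mul_sqrt_self A' hA'
  -- For `S = √A`, `‖SE‖² = ‖EAE‖ ≤ ‖ECE‖ ≤ ε`. Passing to the square root is what turns the order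
  -- relation into a norm bound; squaring back by `nbhd_mul` costs the second `δ`.
  have hS : S ∈ nbhd τ (Real.sqrt ε) δ := by
    refine ⟨E, hE, Real.le_sqrt_of_sq_le ?_, hEt⟩
    change ‖CFC.sqrt A' * E‖ ^ 2 ≤ ε
    have h1 : star (CFC.sqrt A' * E) * (CFC.sqrt A' * E) = E * A' * E := by
      rw [star_mul, hSs, hEs, mul_assoc, ← mul_assoc _ _ (E : H →L[ℂ] H), hSS, mul_assoc]
    rw [sq, ← CStarRing.norm_star_mul_self, h1]
    have h2 : 0 ≤ E * A' * E := by
      have := star_right_conjugate_nonneg hA' (E : H →L[ℂ] H)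
      rwa [hEs] at this
    have h3 : E * A' * E ≤ E * (C : H →L[ℂ] H) * E := by
      have := star_right_conjugate_le_conjugate (show A' ≤ (C : H →L[ℂ] H) from hAC)
        (E : H →L[ℂ] H)
      rwa [hEs] at this
    refine (CStarAlgebra.norm_le_norm_of_nonneg_of_le h2 h3).trans ?_
    rw [mul_assoc]
    exact (norm_mul_le _ _).trans
      ((mul_le_of_le_one_left (norm_nonneg _) (norm_proj_le hE)).trans hCE)
  have h := nbhd_mul τ hS hS
  rw [Real.mul_self_sqrt hε] at h
  rwa [show S * S = A from Subtype.ext hSS] at h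

open UniformSpace Filter Topology

/-! ### Closedness in the measure topology of the algebra -/

theorem tendsto_const_sub_nhds_zero (A : MeasureAlgebra τ) :
    Tendsto (fun B : MeasureAlgebra τ => A - B) (𝓝 A) (𝓝 0) := by
  have h : Continuous fun B : MeasureAlgebra τ => A - B := continuous_const.sub continuous_id
  simpa only [sub_self] using h.tendsto A

/-- Rests on faithfulness of the trace: only `0` lies in every basic neighbourhood. It makes the
equalizer of the adjoint and the identity closed. -/
instance : T2Space (MeasureAlgebra τ) := by
  suffices T1Space (MeasureAlgebra τ) by infer_instance
  refine IsTopologicalAddGroup.t1Space _ ?_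
  rw [← closure_subset_iff_isClosed]
  intro A hA
  refine eq_zero_of_forall_mem_nbhd τ fun η hη => ?_
  have hs := (MeasureAlgebra.nhds_zero_hasBasis τ).mem_of_mem (i := (η, η)) ⟨hη, hη⟩
  have ht := tendsto_const_sub_nhds_zero τ A
  obtain ⟨B, hB, hB0⟩ := mem_closure_iff_nhds.1 hA _ (ht hs)
  have h : A - B = A := by rw [Set.mem_singleton_iff.1 hB0, sub_zero]
  exact h ▸ hB

theorem isClosed_selfAdjointPart : IsClosed (selfAdjointPart τ) :=
  isClosed_eq (MeasureAlgebra.uniformContinuous_star τ).continuous continuous_id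

theorem isSelfAdjoint_of_mem_positivePart {A : MeasureAlgebra τ} (hA : A ∈ positivePart τ) :
    IsSelfAdjoint A :=
  Subtype.ext (ContinuousLinearMap.IsPositive.isSelfAdjoint hA)

theorem mem_positivePart_iff {A : M.toStarSubalgebra} :
    (show MeasureAlgebra τ from A) ∈ positivePart τ ↔ 0 ≤ A :=
  (ContinuousLinearMap.nonneg_iff_isPositive A.1).symm

theorem isClosed_positivePart : IsClosed (positivePart τ) := by
  rw [← closure_subset_iff_isClosed]
  intro A hA
  -- Self-adjointness of the limit comes first, because the negative part is only meaningful for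
  -- self-adjoint `A`.
  have hsa : IsSelfAdjoint A := closure_minimal
    (fun B hB => isSelfAdjoint_of_mem_positivePart τ hB) (isClosed_selfAdjointPart τ) hA
  refine (mem_positivePart_iff τ).2 (nonneg_of_forall_sub_mem_nbhd τ hsa fun η hη => ?_)
  have hs := (MeasureAlgebra.nhds_zero_hasBasis τ).mem_of_mem (i := (η, η)) ⟨hη, hη⟩
  have ht := tendsto_const_sub_nhds_zero τ A
  obtain ⟨B, hB, hB0⟩ := mem_closure_iff_nhds.1 hA _ (ht hs)
  exact ⟨B, (mem_positivePart_iff τ).1 hB0, hB⟩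

/-- If a sum of positive operators tends to zero in measure, so does each summand. -/
theorem tendsto_zero_of_add_tendsto_zero {ι : Type*} {l : Filter ι} {f g : ι → MeasureAlgebra τ}
    (hf : ∀ᶠ i in l, f i ∈ positivePart τ) (hg : ∀ᶠ i in l, g i ∈ positivePart τ)
    (h : Tendsto (fun i => f i + g i) l (𝓝 0)) : Tendsto f l (𝓝 0) := by
  rw [(MeasureAlgebra.nhds_zero_hasBasis τ).tendsto_right_iff] at h ⊢
  rintro ⟨ε, δ⟩ ⟨hε, hδ⟩
  -- The domination lemma doubles the trace parameter, hence `δ / 2`.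
  filter_upwards [hf, hg, h (ε, δ / 2) ⟨hε, half_pos hδ⟩] with i hi hi' hi''
  have h1 : (0 : H →L[ℂ] H) ≤ (g i).toOperator :=
    (ContinuousLinearMap.nonneg_iff_isPositive _).2 hi'
  have h2 := mem_nbhd_of_nonneg_of_le τ ((mem_positivePart_iff τ).1 hi)
    (show (f i).toOperator ≤ (f i).toOperator + (g i).toOperator from le_add_of_nonneg_right h1)
    hi''
  rw [add_halves] at h2
  exact h2

/-! ### Self-adjoint elements and the positive cone of the completion -/

theorem closure_image_selfAdjointPart :
    closure ((fun A : MeasureAlgebra τ => (A : MeasureCompletion τ)) '' selfAdjointPart τ) =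
      {A : MeasureCompletion τ | IsSelfAdjoint A} := by
  refine Set.Subset.antisymm (closure_minimal ?_ (isClosed_eq continuous_star continuous_id)) ?_
  · rintro _ ⟨A, hA, rfl⟩
    change star (A : MeasureCompletion τ) = A
    rw [← MeasureCompletion.coe_star, show star A = A from hA]
  · intro A hA
    have h1 : (2⁻¹ : ℂ) • (A + star A) = A := by
      rw [show star A = A from hA, ← two_smul ℂ, smul_smul]; simp
    have hc : Continuous fun X : MeasureCompletion τ => (2⁻¹ : ℂ) • (X + star X) :=
      (continuous_id.add continuous_star).const_smul (2⁻¹ : ℂ)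
    rw [← h1]
    -- Taking real parts is continuous, fixes `A`, and sends the dense image of the algebra into the
    -- image of its self-adjoint part.
    refine map_mem_closure (f := fun X => (2⁻¹ : ℂ) • (X + star X)) hc (Completion.denseRange_coe A) ?_
    rintro _ ⟨a, rfl⟩
    refine ⟨(2⁻¹ : ℂ) • (a + star a), ?_, ?_⟩
    · change star ((2⁻¹ : ℂ) • (a + star a)) = (2⁻¹ : ℂ) • (a + star a)
      rw [star_smul, star_add, star_star, add_comm]
      simp
    · change (((2⁻¹ : ℂ) • (a + star a) : MeasureAlgebra τ) : MeasureCompletion τ) = _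
      rw [Completion.coe_smul, Completion.coe_add, MeasureCompletion.coe_star]

theorem completedPositivePart_subset :
    completedPositivePart τ ⊆ {A : MeasureCompletion τ | IsSelfAdjoint A} := by
  rw [← closure_image_selfAdjointPart]
  exact closure_mono (Set.image_mono fun A hA => isSelfAdjoint_of_mem_positivePart τ hA)

theorem zero_mem_completedPositivePart : (0 : MeasureCompletion τ) ∈ completedPositivePart τ :=
  subset_closure ⟨0, (mem_positivePart_iff τ).2 le_rfl, Completion.coe_zero⟩

theorem add_mem_completedPositivePart {A B : MeasureCompletion τ}
    (hA : A ∈ completedPositivePart τ) (hB : B ∈ completedPositivePart τ) :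
    A + B ∈ completedPositivePart τ := by
  refine map_mem_closure₂ continuous_add hA hB ?_
  rintro _ ⟨a, ha, rfl⟩ _ ⟨b, hb, rfl⟩
  exact ⟨a + b, ContinuousLinearMap.IsPositive.add ha hb, Completion.coe_add _ _⟩

theorem ofReal_smul_mem_completedPositivePart {c : ℝ} (hc : 0 ≤ c) {A : MeasureCompletion τ}
    (hA : A ∈ completedPositivePart τ) : (c : ℂ) • A ∈ completedPositivePart τ := by
  refine map_mem_closure (continuous_const_smul (c : ℂ)) hA ?_
  rintro _ ⟨a, ha, rfl⟩
  refine ⟨(c : ℂ) • a, ?_, Completion.coe_smul _ _⟩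
  exact ContinuousLinearMap.IsPositive.smul_of_nonneg ha (by exact_mod_cast hc)

theorem smul_mem_completedPositivePart {c : ℝ} (hc : 0 ≤ c) {A : MeasureCompletion τ}
    (hA : A ∈ completedPositivePart τ) : c • A ∈ completedPositivePart τ :=
  ofReal_smul_mem_completedPositivePart τ hc hA

/-- Positive `a → A` and `b → -A` have `a + b → 0`, so `a → 0` by domination, and limits are unique.
-/
theorem eq_zero_of_mem_of_neg_mem {A : MeasureCompletion τ}
    (hA : A ∈ completedPositivePart τ) (hA' : -A ∈ completedPositivePart τ) : A = 0 := by
  let c : MeasureAlgebra τ → MeasureCompletion τ := fun a => a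
  -- This filter plays the role of a net of positive operators converging to `X`; it is nontrivial
  -- because `X` lies in the closure.
  have hc : ∀ {X : MeasureCompletion τ}, X ∈ completedPositivePart τ →
      (comap c (𝓝 X) ⊓ 𝓟 (positivePart τ)).NeBot := by
    intro X hX
    have h := mem_closure_iff_clusterPt.1 hX
    rw [ClusterPt, ← map_principal, ← Filter.push_pull'] at h
    exact Filter.map_neBot_iff c |>.1 h
  have := hc hA
  have := hc hA'
  set l₁ := comap c (𝓝 A) ⊓ 𝓟 (positivePart τ)
  set l₂ := comap c (𝓝 (-A)) ⊓ 𝓟 (positivePart τ)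
  have t₁ : Tendsto (fun p : MeasureAlgebra τ × MeasureAlgebra τ => c p.1) (l₁ ×ˢ l₂) (𝓝 A) :=
    ((tendsto_comap (f := c) (x := 𝓝 A)).mono_left inf_le_left).comp tendsto_fst
  have t₂ : Tendsto (fun p : MeasureAlgebra τ × MeasureAlgebra τ => c p.2) (l₁ ×ˢ l₂) (𝓝 (-A)) :=
    ((tendsto_comap (f := c) (x := 𝓝 (-A))).mono_left inf_le_left).comp tendsto_snd
  have p₁ : ∀ᶠ p in l₁ ×ˢ l₂, p.1 ∈ positivePart τ :=
    tendsto_fst.eventually (mem_inf_of_right (mem_principal_self _))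
  have p₂ : ∀ᶠ p in l₁ ×ˢ l₂, p.2 ∈ positivePart τ :=
    tendsto_snd.eventually (mem_inf_of_right (mem_principal_self _))
  have t₃ : Tendsto (fun p : MeasureAlgebra τ × MeasureAlgebra τ => p.1 + p.2) (l₁ ×ˢ l₂) (𝓝 0) := by
    -- The algebra carries the topology induced from its completion, so convergence of `a + b` to
    -- `0` may be checked there.
    rw [(Completion.isUniformInducing_coe (MeasureAlgebra τ)).isInducing.tendsto_nhds_iff]
    have h := t₁.add t₂
    rw [add_neg_cancel] at h
    rw [Completion.coe_zero]
    exact h.congr fun p => (Completion.coe_add _ _).symm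
  have t₄ := tendsto_zero_of_add_tendsto_zero τ p₁ p₂ t₃
  have t₅ := ((Completion.continuous_coe (MeasureAlgebra τ)).tendsto 0).comp t₄
  rw [Completion.coe_zero] at t₅
  exact tendsto_nhds_unique t₁ t₅

/-! ### Joint continuity of scalar multiplication, and the order -/

theorem continuous_algebraMap_measureAlgebra : Continuous (algebraMap ℂ (MeasureAlgebra τ)) := by
  refine continuous_of_continuousAt_zero (algebraMap ℂ (MeasureAlgebra τ)) ?_
  change Tendsto _ _ _
  rw [map_zero, (MeasureAlgebra.nhds_zero_hasBasis τ).tendsto_right_iff]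
  rintro ⟨ε, δ⟩ ⟨hε, hδ⟩
  filter_upwards [Metric.closedBall_mem_nhds (0 : ℂ) hε] with c hc
  refine mem_nbhd_of_norm_le τ (le_of_lt hδ) ?_
  change ‖algebraMap ℂ (H →L[ℂ] H) c‖ ≤ ε
  rw [Algebra.algebraMap_eq_smul_one, norm_smul]
  rw [mem_closedBall_zero_iff] at hc
  exact (mul_le_of_le_one_right (norm_nonneg _) ContinuousLinearMap.norm_id_le).trans hc

/-- Scaling by `c` is multiplication by the image of `c`, which depends continuously on `c`; joint
continuity then comes from the topological ring. -/
instance : ContinuousSMul ℂ (MeasureCompletion τ) where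
  continuous_smul := by
    have h : (fun p : ℂ × MeasureCompletion τ => p.1 • p.2) =
        fun p => ((algebraMap ℂ (MeasureAlgebra τ) p.1 : MeasureAlgebra τ) :
          MeasureCompletion τ) * p.2 := by
      funext p
      exact Algebra.smul_def p.1 p.2
    rw [h]
    exact ((Completion.continuous_coe _).comp
      ((continuous_algebraMap_measureAlgebra τ).comp continuous_fst)).mul continuous_snd

/-- The order on the self-adjoint elements of the completion, with positive cone the closure of the
set of positive operators. -/
@[reducible]
def selfAdjointOrder : PartialOrder (selfAdjoint (MeasureCompletion τ)) where
  le A B := ((B - A : selfAdjoint (MeasureCompletion τ)) : MeasureCompletion τ) ∈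
    completedPositivePart τ
  le_refl A := by
    rw [sub_self]
    exact zero_mem_completedPositivePart τ
  le_trans A B C hAB hBC := by
    have h := add_mem_completedPositivePart τ hBC hAB
    rwa [← AddSubgroup.coe_add, sub_add_sub_cancel] at h
  le_antisymm A B hAB hBA := by
    have h : ((B - A : selfAdjoint (MeasureCompletion τ)) : MeasureCompletion τ) = 0 := by
      refine eq_zero_of_mem_of_neg_mem τ hAB ?_
      rwa [← AddSubgroup.coe_neg, neg_sub]
    exact (sub_eq_zero.1 (Subtype.ext h)).symm

/-- The closure of the set of positive operators, as a convex cone. -/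
def positiveCone : ConvexCone ℝ (MeasureCompletion τ) where
  carrier := completedPositivePart τ
  smul_mem' _ hc _ hA := smul_mem_completedPositivePart τ (le_of_lt hc) hA
  add_mem' _ hA _ hB := add_mem_completedPositivePart τ hA hB

end MeasureTopology

end

open MeasureTopology in
theorem proposition3p7 {H : Type*} [NormedAddCommGroup H] [InnerProductSpace ℂ H] [CompleteSpace H]
    (M : VonNeumannAlgebra H) (hM : IsTypeII1Factor M) (τ : FaithfulNormalTracialState M) :
    -- part (i)
    (IsClosed (selfAdjointPart τ) ∧
      closure ((fun A : MeasureAlgebra τ => (A : MeasureCompletion τ)) '' selfAdjointPart τ) =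
        {A : MeasureCompletion τ | IsSelfAdjoint A}) ∧
    -- part (ii)
    (IsClosed (positivePart τ) ∧
      ∃ K : ConvexCone ℝ (MeasureCompletion τ),
        (K : Set (MeasureCompletion τ)) = completedPositivePart τ ∧ K.Pointed ∧ K.Salient) ∧
    -- the completion is a complex topological `*`-algebra
    (IsTopologicalRing (MeasureCompletion τ) ∧ ContinuousSMul ℂ (MeasureCompletion τ) ∧
      StarModule ℂ (MeasureCompletion τ) ∧ ContinuousStar (MeasureCompletion τ)) ∧
    -- its self-adjoint elements form an ordered real vector space with positive cone the closure
    completedPositivePart τ ⊆ {A : MeasureCompletion τ | IsSelfAdjoint A} ∧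
    ∃ _ : PartialOrder (selfAdjoint (MeasureCompletion τ)),
      (∀ A B : selfAdjoint (MeasureCompletion τ),
        A ≤ B ↔ ((B - A : selfAdjoint (MeasureCompletion τ)) : MeasureCompletion τ) ∈
          completedPositivePart τ) ∧
      IsOrderedAddMonoid (selfAdjoint (MeasureCompletion τ)) ∧
      IsOrderedModule ℝ (selfAdjoint (MeasureCompletion τ)) := by

  refine ⟨⟨isClosed_selfAdjointPart τ, closure_image_selfAdjointPart τ⟩,
    ⟨isClosed_positivePart τ, positiveCone τ, rfl, zero_mem_completedPositivePart τ,
      fun A hA hA0 hA' => hA0 (eq_zero_of_mem_of_neg_mem τ hA hA')⟩,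
    ⟨inferInstance, inferInstance, inferInstance, inferInstance⟩,
    completedPositivePart_subset τ, selfAdjointOrder τ, fun _ _ => Iff.rfl, ?_, ?_⟩
  · let _ := selfAdjointOrder τ
    refine { add_le_add_left := fun A B hAB C => ?_ }
    change ((B + C - (A + C) : selfAdjoint (MeasureCompletion τ)) : MeasureCompletion τ) ∈
      completedPositivePart τ
    rw [add_sub_add_right_eq_sub]
    exact hAB
  · let _ := selfAdjointOrder τ
    refine { smul_le_smul_of_nonneg_left := fun c hc A B hAB => ?_,
             smul_le_smul_of_nonneg_right := fun A hA c d hcd => ?_ }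
    · change ((c • B - c • A : selfAdjoint (MeasureCompletion τ)) : MeasureCompletion τ) ∈
        completedPositivePart τ
      rw [← smul_sub]
      exact smul_mem_completedPositivePart τ hc hAB
    · change ((d • A - c • A : selfAdjoint (MeasureCompletion τ)) : MeasureCompletion τ) ∈
        completedPositivePart τ
      rw [← sub_smul]
      -- The hypothesis `0 ≤ A` unfolds to membership of `A - 0` in the cone.
      have hA' : ((A - 0 : selfAdjoint (MeasureCompletion τ)) : MeasureCompletion τ) ∈
        completedPositivePart τ := hA
      rw [sub_zero] at hA'
      exact smul_mem_completedPositivePart τ (sub_nonneg.2 hcd) hA'
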